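/- **Theorem (Ringel, terminal segment).** Let $\mathcal A$ be an abelian length category, i.e. an abelian category in which every object has a finite composition series and whose isomorphism classes of objects form a set. Write $\operatorname{ind}\mathcal A$ for the set of isomorphism classes of indecomposable objects, ordered by $X\subseteq Y$ if and only if there is a monomorphism $X\to Y$, and $\ell(X)$ for the composition length of $X$. Order the finite subsets of $\mathbb N=\{1,2,\dots\}$ lexicographically: $U\le V$ if and only if $\min(V\setminus U)\le\min(U\setminus V)$, where $\min\emptyset=\infty$. The Gabriel-Roiter measure of $X\in\operatorname{ind}\mathcal A$ is $$\mu(X)=\max\{\,\{\ell(X_1),\dots,\ell(X_r)\}\;:\; X_1\subset X_2\subset\dots\subset X_r=X \text{ a finite chain in } \operatorname{ind}\mathcal A\,\},$$ the maximum being taken in this lexicographic order. Suppose that - $\operatorname{ind}\mathcal A$ is infinite; - $\mathcal A$ has a cogenerator, i.e. an object $Q$ such that every object of $\mathcal A$ admits a monomorphism into a finite direct sum of copies of $Q$; - for every indecomposable object $Z$ there is a right almost split map $\psi\colon Y\to Z$ in $\mathcal A$, i.e. $\psi$ is not a split epimorphism and every map $Y'\to Z$ that is not a split epimorphism factors through $\psi$.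 Then there exist infinitely many values $\mu(X^1)>\mu(X^2)>\mu(X^3)>\cdots$ with $X^i\in\operatorname{ind}\mathcal A$ such that: 1. if $X\in\operatorname{ind}\mathcal A$ satisfies $\mu(X)\ne\mu(X^i)$ for all $i$, then $\mu(X^i)>\mu(X)$ for all $i$; 2. for every $i$, the set $\{X\in\operatorname{ind}\mathcal A : \mu(X)=\mu(X^i)\}$ is finite. -/

import Mathlib

open CategoryTheory CategoryTheory.Limits

universe v u

namespace GabrielRoiter

/-! ### Finite sets of natural numbers with the lexicographic order -/

/-- The finite sets (equivalently, finite chains) of natural numbers, to be ordered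
lexicographically. -/
structure ChainNat : Type where
  carrier : Finset ℕ

namespace ChainNat

/-- The lexicographic order: `X ≤ Y` iff `min (Y \ X) ≤ min (X \ Y)`, where `min ∅` lies above
every natural number. -/
instance : LE ChainNat where
  le X Y := (Y.carrier \ X.carrier).min ≤ (X.carrier \ Y.carrier).min

theorem le_def (X Y : ChainNat) :
    X ≤ Y ↔ (Y.carrier \ X.carrier).min ≤ (X.carrier \ Y.carrier).min := Iff.rfl

/-- The same finite set, viewed in the colexicographic order of the opposite of `ℕ`. -/
def toDualColex (X : ChainNat) : Colex (Finset ℕᵒᵈ) :=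
  toColex (X.carrier.map OrderDual.toDual.toEmbedding)

theorem toDualColex_injective : Function.Injective toDualColex := by
  rintro ⟨X⟩ ⟨Y⟩ h
  have h' := Finset.map_injective _ (toColex.injective h)
  simpa using h'

theorem toDualColex_le_iff (X Y : ChainNat) : toDualColex X ≤ toDualColex Y ↔ X ≤ Y := by
  rw [le_def, toDualColex, toDualColex, Finset.Colex.toColex_le_toColex, Finset.le_min_iff]
  constructor
  · intro h a ha
    rw [Finset.mem_sdiff] at ha
    obtain ⟨b, hb, hb', hab⟩ := h (a := OrderDual.toDual a) (by simpa using ha.1)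
      (by simpa using ha.2)
    refine (Finset.min_le (a := OrderDual.ofDual b) ?_).trans (WithTop.coe_le_coe.2 hab)
    rw [Finset.mem_sdiff]
    constructor
    · obtain ⟨c, hc, rfl⟩ := Finset.mem_map.1 hb
      exact hc
    · intro hc
      exact hb' (Finset.mem_map.2 ⟨_, hc, rfl⟩)
  · intro h a ha ha'
    obtain ⟨a, haX, rfl⟩ := Finset.mem_map.1 ha
    have haY : a ∉ Y.carrier := fun hc => ha' (Finset.mem_map.2 ⟨a, hc, rfl⟩)
    have hle := h a (Finset.mem_sdiff.2 ⟨haX, haY⟩)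
    obtain ⟨b, hb⟩ := WithTop.ne_top_iff_exists.1 (ne_top_of_le_ne_top WithTop.coe_ne_top hle)
    have hbm := Finset.mem_sdiff.1 (Finset.mem_of_min hb.symm)
    rw [← hb] at hle
    refine ⟨OrderDual.toDual b, Finset.mem_map.2 ⟨b, hbm.1, rfl⟩, fun hc => ?_,
      ?_⟩
    · obtain ⟨c, hcX, hcb⟩ := Finset.mem_map.1 hc
      have : c = b := OrderDual.toDual.injective hcb
      exact hbm.2 (this ▸ hcX)
    · have hba : b ≤ a := WithTop.coe_le_coe.1 hle
      exact OrderDual.toDual_le_toDual.2 hba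

noncomputable instance : LinearOrder ChainNat where
  le_refl X := le_rfl (a := (X.carrier \ X.carrier).min)
  le_trans X Y Z h₁ h₂ := by
    rw [← toDualColex_le_iff] at h₁ h₂ ⊢
    exact h₁.trans h₂
  le_antisymm X Y h₁ h₂ := by
    rw [← toDualColex_le_iff] at h₁ h₂
    exact toDualColex_injective (le_antisymm h₁ h₂)
  le_total X Y := by
    rw [← toDualColex_le_iff, ← toDualColex_le_iff]
    exact le_total _ _
  toDecidableLE := Classical.decRel _

end ChainNat

/-! ### The chain length function of a preordered set -/

section ChainLength

variable {S : Type*} [Preorder S]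

/-- `Ch(S, x)`: the finite chains in `S` with maximal element `x`. -/
def chainsWithMax (x : S) : Set (Finset S) :=
  {X | IsChain (· ≤ ·) (X : Set S) ∧ IsGreatest (X : Set S) x}

open Classical in
/-- The sets `lam(X)` of natural numbers, for `X` a finite chain in `S` with maximum `x`. -/
def chainLengths (lam : S → ℕ) (x : S) : Set ChainNat :=
  {c | ∃ X ∈ chainsWithMax x, c = ⟨X.image lam⟩}

open Classical in
/-- The chain length function `lam*(x) = max {lam(X) | X ∈ Ch(S, x)}`. The maximum exists as soon
as `lam` is monotone, see `isGreatest_chainLength`; otherwise the value may be junk. -/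
noncomputable def chainLength (lam : S → ℕ) (x : S) : ChainNat :=
  if h : ∃ m, IsGreatest (chainLengths lam x) m then h.choose else ⟨∅⟩

theorem isGreatest_chainLength {lam : S → ℕ} (h : Monotone lam) (x : S) :
    IsGreatest (chainLengths lam x) (chainLength lam x) := by
  classical
  have hfin : (chainLengths lam x).Finite := by
    refine ((Finset.finite_toSet (Finset.range (lam x + 1)).powerset).image
      ChainNat.mk).subset ?_
    rintro c ⟨X, hX, rfl⟩
    refine ⟨X.image lam, ?_, rfl⟩
    simp only [Finset.coe_powerset, Set.mem_preimage, Set.mem_powerset_iff, Finset.coe_subset]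
    intro n hn
    obtain ⟨y, hy, rfl⟩ := Finset.mem_image.1 hn
    exact Finset.mem_range.2 (Nat.lt_succ_of_le (h (hX.2.2 hy)))
  have hne : (chainLengths lam x).Nonempty :=
    ⟨⟨({x} : Finset S).image lam⟩, {x}, ⟨by simp, by simp⟩, rfl⟩
  obtain ⟨m, hm, hmax⟩ := Set.exists_max_image _ id hfin hne
  have hex : ∃ m, IsGreatest (chainLengths lam x) m := ⟨m, hm, fun c hc => hmax c hc⟩
  rw [chainLength, dif_pos hex]
  exact hex.choose_spec

end ChainLength

/-! ### Length categories -/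


variable {A : Type u} [Category.{v} A] [Abelian A]

/-- `HasCompositionSeries X n` means that `X` has a composition series
`0 = X₀ ⊆ X₁ ⊆ ⋯ ⊆ Xₙ = X` of length `n`, i.e. there are monomorphisms
`X₀ → X₁ → ⋯ → Xₙ = X` with `X₀ = 0` and with every cokernel `Xᵢ / Xᵢ₋₁` simple. -/
inductive HasCompositionSeries : A → ℕ → Prop
  | zero {X : A} (hX : IsZero X) : HasCompositionSeries X 0
  | succ {X Y : A} {n : ℕ} (f : X ⟶ Y) (hf : Mono f) (hs : Simple (cokernel f))
      (hX : HasCompositionSeries X n) : HasCompositionSeries Y (n + 1)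

theorem HasCompositionSeries.of_iso {X Y : A} {n : ℕ} (h : HasCompositionSeries X n)
    (e : X ≅ Y) : HasCompositionSeries Y n := by
  cases h with
  | zero hX => exact .zero (hX.of_iso e.symm)
  | succ f hf hs hX =>
    refine .succ (f ≫ e.hom) (mono_comp _ _) ?_ hX
    have := hs
    exact Simple.of_iso (cokernelCompIsIso f e.hom)

/-- The length of an object: the length of a composition series. By the Jordan-Hölder theorem all
composition series of `X` have the same length, so that taking the infimum means no choice. -/
noncomputable def length (X : A) : ℕ := sInf {n | HasCompositionSeries X n}

theorem length_eq_of_iso {X Y : A} (e : X ≅ Y) : length X = length Y := by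
  unfold length
  congr 1
  ext n
  exact ⟨fun h => h.of_iso e, fun h => h.of_iso e.symm⟩

variable (A) in
/-- An abelian category is a length category if all its objects have finite length. (Its
isomorphism classes always form a set here, namely a type in the universe of `A`.) -/
class IsLengthCategory : Prop where
  finite_length : ∀ X : A, ∃ n, HasCompositionSeries X n

/-! ### Isomorphism classes of indecomposable objects -/

variable (A) in
/-- Isomorphism of indecomposable objects. -/
def indSetoid : Setoid {X : A // Indecomposable X} :=
  (isIsomorphicSetoid A).comap Subtype.val

variable (A) in
/-- `ind A`: the isomorphism classes of indecomposable objects of `A`. -/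
def Ind : Type u := Quotient (indSetoid A)

namespace Ind

/-- The isomorphism class of an indecomposable object. -/
def mk (X : A) (hX : Indecomposable X) : Ind A := Quotient.mk (indSetoid A) ⟨X, hX⟩

/-- The subobject relation on `ind A`: `X ⊆ Y` iff there is a monomorphism `X ⟶ Y`. (In a length
category this relation is moreover antisymmetric.) -/
instance : Preorder (Ind A) where
  le := Quotient.lift₂ (fun X Y => ∃ f : X.1 ⟶ Y.1, Mono f) (by
    rintro X Y X' Y' ⟨e⟩ ⟨e'⟩
    refine propext ⟨?_, ?_⟩
    · rintro ⟨f, hf⟩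
      exact ⟨e.inv ≫ f ≫ e'.hom, inferInstance⟩
    · rintro ⟨f, hf⟩
      exact ⟨e.hom ≫ f ≫ e'.inv, inferInstance⟩)
  le_refl := by
    rintro ⟨X⟩
    exact ⟨𝟙 _, inferInstance⟩
  le_trans := by
    rintro ⟨X⟩ ⟨Y⟩ ⟨Z⟩ ⟨f, hf⟩ ⟨g, hg⟩
    exact ⟨f ≫ g, mono_comp f g⟩

theorem mk_le_mk {X Y : A} (hX : Indecomposable X) (hY : Indecomposable Y) :
    mk X hX ≤ mk Y hY ↔ ∃ f : X ⟶ Y, Mono f := Iff.rfl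

/-- The composition length on `ind A`. -/
noncomputable def len : Ind A → ℕ :=
  Quotient.lift (fun X => length X.1) (by
    rintro X Y ⟨e⟩
    exact length_eq_of_iso e)

/-- The Gabriel-Roiter measure `ind A → Ch(ℕ)`: the chain length function induced by the
composition length. -/
noncomputable def measure (X : Ind A) : ChainNat := chainLength len X

end Ind

/-! ### Cogenerators and right almost split maps -/

attribute [local instance] Abelian.hasFiniteBiproducts

/-- `Q` is a cogenerator if every object has a monomorphism into a (finite) direct sum of copies
of `Q`. -/
def IsCogenerator (Q : A) : Prop :=
  ∀ X : A, ∃ (n : ℕ) (f : X ⟶ ⨁ (fun _ : Fin n => Q)), Mono f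

/-- `g : Y ⟶ Z` is right almost split if it is not a split epimorphism and every `h : Y' ⟶ Z` that
is not a split epimorphism factors through `g`. -/
def IsRightAlmostSplit {Y Z : A} (g : Y ⟶ Z) : Prop :=
  ¬ IsSplitEpi g ∧ ∀ (Y' : A) (h : Y' ⟶ Z), ¬ IsSplitEpi h → ∃ k : Y' ⟶ Y, k ≫ g = h

variable (A) in
/-- Every indecomposable object `Z` admits a right almost split map ending at `Z`. -/
def HasRightAlmostSplitMaps : Prop :=
  ∀ Z : A, Indecomposable Z → ∃ (Y : A) (g : Y ⟶ Z), IsRightAlmostSplit g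

end GabrielRoiter

/-!
The measures are listed from the top. It is enough to know that, for every finite set `F` of
isomorphism classes of indecomposable objects, the largest measure of a class outside `F` exists and
is attained by finitely many classes only (`Ind.exists_max_measure_notMem`): starting from `F = ∅`
and repeatedly adjoining the classes of largest measure outside `F` gives the sequence.

This rests on two facts.

* Gabriel's main property (`Ind.main_property`): if an indecomposable `X` is cogenerated by
  indecomposable objects `Y`, then `μ(X) ≤ μ(Y)` for one of them, and if moreover no `μ(Y)` exceeds
  `μ(X)`, then one of the given morphisms `X ⟶ Y` is an isomorphism.
* The indecomposable objects outside `F` are cogenerated by a finite set `W` of objects outside `F`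
  (`Ind.exists_finite_cogenerating`).

By the main property the largest measure outside `F` is the largest measure on `W`, and it is
attained only on `W`.

For `W` one takes the indecomposable summands outside `F` of the cogenerator `Q` and of the sources
of right almost split maps ending in members of `F`. If `X` is indecomposable and outside `F`, then
no morphism from `X` to a member of `F` is a split epimorphism, so that it factors through a right
almost split map. Iterating this, a morphism `X ⟶ Q` becomes a sum of morphisms that pass through
`W` and of morphisms ending in a long composite of non-isomorphisms between members of `F`. The
latter composites vanish by the Harada-Sai lemma (`IsNonIsoComposite.length_image_le`), because the
lengths of the members of the finite set `F` are bounded.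
-/

namespace GabrielRoiter

/-! ### Lengths of subobjects and quotients -/

section Length

variable {A : Type u} [Category.{v} A] [Abelian A]

theorem isIso_of_mono_of_cancel {X Y : A} (f : X ⟶ Y) [Mono f]
    (h : ∀ {T : A} (q : Y ⟶ T), f ≫ q = 0 → q = 0) : IsIso f :=
  have := Preadditive.epi_of_cancel_zero f h
  isIso_of_mono_of_epi f

theorem isIso_of_epi_of_cancel {X Y : A} (f : X ⟶ Y) [Epi f]
    (h : ∀ {T : A} (q : T ⟶ X), q ≫ f = 0 → q = 0) : IsIso f :=
  have := Preadditive.mono_of_cancel_zero f h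
  isIso_of_mono_of_epi f

theorem isIso_of_retract_of_indecomposable {V X : A} (hX : Indecomposable X) (hV : ¬ IsZero V)
    (i : V ⟶ X) (r : X ⟶ V) (h : i ≫ r = 𝟙 V) : IsIso i := by
  have : IsSplitMono i := ⟨⟨⟨r, h⟩⟩⟩
  have e := biprod.uniqueUpToIso _ _
    (isBilimitBinaryBiconeOfIsSplitMonoOfCokernel (cokernelIsCokernel i))
  have hz : IsZero (cokernel i) := (hX.2 _ _ e).resolve_left hV
  refine isIso_of_mono_of_cancel i fun q hq => ?_
  rw [← cokernel.π_desc i q hq, hz.eq_of_src (cokernel.desc i q hq) 0, comp_zero]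

/-- A composition series of `Y` induces one on every subobject `X` by intersection. -/
theorem HasCompositionSeries.exists_of_mono {Y : A} {n : ℕ} (h : HasCompositionSeries Y n) :
    ∀ {X : A} (f : X ⟶ Y) [Mono f],
      ∃ m, m ≤ n ∧ HasCompositionSeries X m ∧ (m = n → IsIso f) := by
  induction h with
  | zero hY =>
    intro X f _
    exact ⟨0, le_rfl, .zero (hY.of_mono f),
      fun _ => isIso_of_mono_of_cancel f fun q _ => hY.eq_of_src _ _⟩
  | @succ Y' Y n g hg hs _ ih =>
    intro X f _
    by_cases hu : f ≫ cokernel.π g = 0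
    · have hl : Abelian.monoLift g f hu ≫ g = f := Abelian.monoLift_comp g f hu
      have : Mono (Abelian.monoLift g f hu) := mono_of_mono_fac hl
      obtain ⟨m, hm, hX, -⟩ := ih (Abelian.monoLift g f hu)
      exact ⟨m, by omega, hX, fun h => by omega⟩
    · set p := f ≫ cokernel.π g with hp
      have : Epi p := epi_of_nonzero_to_simple hu
      have hk : (kernel.ι p ≫ f) ≫ cokernel.π g = 0 := by
        rw [Category.assoc, ← hp, kernel.condition]
      let l := Abelian.monoLift g (kernel.ι p ≫ f) hk
      have hl : l ≫ g = kernel.ι p ≫ f := Abelian.monoLift_comp g _ hk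
      have : Mono l := mono_of_mono_fac hl
      obtain ⟨m, hm, hX, hiso⟩ := ih l
      have : IsIso (Abelian.factorThruCoimage p) := Abelian.isIso_factorThruCoimage p
      have hsim : Simple (cokernel (kernel.ι p)) :=
        Simple.of_iso (asIso (Abelian.factorThruCoimage p))
      refine ⟨m + 1, by omega, .succ (kernel.ι p) inferInstance hsim hX, fun h => ?_⟩
      have := hiso (by omega)
      refine isIso_of_mono_of_cancel f fun q hq => ?_
      have hgq : g ≫ q = 0 := by
        rw [← cancel_epi l, ← Category.assoc, hl, Category.assoc, hq, comp_zero, comp_zero]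
      have hq' : cokernel.π g ≫ cokernel.desc g q hgq = q := cokernel.π_desc _ _ _
      have : cokernel.desc g q hgq = 0 := by
        rw [← cancel_epi p, hp, Category.assoc, hq', hq, comp_zero]
      rw [← hq', this, comp_zero]

/-- A composition series of `X` induces one on every quotient `Z` by taking images. -/
theorem HasCompositionSeries.exists_of_epi {X : A} {n : ℕ} (h : HasCompositionSeries X n) :
    ∀ {Z : A} (e : X ⟶ Z) [Epi e],
      ∃ m, m ≤ n ∧ HasCompositionSeries Z m ∧ (m = n → IsIso e) := by
  induction h with
  | zero hX =>
    intro Z e _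
    exact ⟨0, le_rfl, .zero (hX.of_epi e),
      fun _ => isIso_of_epi_of_cancel e fun q _ => hX.eq_of_tgt _ _⟩
  | @succ X' X n g hg hs _ ih =>
    intro Z e _
    obtain ⟨m, hm, hI, hiso⟩ := ih (factorThruImage (g ≫ e))
    have hfac : factorThruImage (g ≫ e) ≫ image.ι (g ≫ e) = g ≫ e := image.fac _
    set i := image.ι (g ≫ e)
    have hd : g ≫ e ≫ cokernel.π i = 0 := by
      simpa using (congrArg (· ≫ cokernel.π i) hfac).symm
    let d := cokernel.desc g (e ≫ cokernel.π i) hd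
    have hd' : cokernel.π g ≫ d = e ≫ cokernel.π i := cokernel.π_desc _ _ _
    have : Epi d := epi_of_epi_fac hd'
    by_cases hd0 : d = 0
    · have : IsIso i := by
        refine isIso_of_mono_of_cancel i fun q hq => ?_
        have h0 : cokernel.π i = 0 := by
          rw [← cancel_epi e, ← hd', hd0, comp_zero, comp_zero]
        rw [← cokernel.π_desc i q hq, h0, zero_comp]
      exact ⟨m, by omega, hI.of_iso (asIso i), fun h => by omega⟩
    · have : IsIso d := isIso_of_epi_of_nonzero hd0
      refine ⟨m + 1, by omega, .succ i inferInstance (Simple.of_iso (asIso d).symm) hI,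
        fun h => ?_⟩
      have := hiso (by omega)
      refine isIso_of_epi_of_cancel e fun q hq => ?_
      have hq0 : q ≫ cokernel.π g = 0 := by
        rw [← cancel_mono d, Category.assoc, hd', ← Category.assoc, hq, zero_comp, zero_comp]
      have hl : Abelian.monoLift g q hq0 ≫ g = q := Abelian.monoLift_comp _ _ _
      have : Abelian.monoLift g q hq0 = 0 := by
        rw [← cancel_mono (factorThruImage (g ≫ e)), ← cancel_mono i, Category.assoc, hfac,
          ← Category.assoc, hl, hq, zero_comp, zero_comp]
      rw [← hl, this, zero_comp]

variable [IsLengthCategory A]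

theorem hasCompositionSeries_length (X : A) : HasCompositionSeries X (length X) :=
  Nat.sInf_mem (IsLengthCategory.finite_length X)

theorem length_le_of_mono {X Y : A} (f : X ⟶ Y) [Mono f] : length X ≤ length Y := by
  obtain ⟨m, hm, hX, -⟩ := (hasCompositionSeries_length Y).exists_of_mono f
  exact (Nat.sInf_le hX).trans hm

theorem isIso_of_mono_of_length_le {X Y : A} (f : X ⟶ Y) [Mono f] (h : length Y ≤ length X) :
    IsIso f := by
  obtain ⟨m, hm, hX, hiso⟩ := (hasCompositionSeries_length Y).exists_of_mono f
  exact hiso (hm.antisymm (h.trans (Nat.sInf_le hX)))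

theorem length_le_of_epi {X Y : A} (f : X ⟶ Y) [Epi f] : length Y ≤ length X := by
  obtain ⟨m, hm, hX, -⟩ := (hasCompositionSeries_length X).exists_of_epi f
  exact (Nat.sInf_le hX).trans hm

theorem isIso_of_epi_of_length_le {X Y : A} (f : X ⟶ Y) [Epi f] (h : length X ≤ length Y) :
    IsIso f := by
  obtain ⟨m, hm, hX, hiso⟩ := (hasCompositionSeries_length X).exists_of_epi f
  exact hiso (hm.antisymm (h.trans (Nat.sInf_le hX)))

theorem isZero_of_length_eq_zero {X : A} (h : length X = 0) : IsZero X := by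
  have hX := hasCompositionSeries_length X
  rw [h] at hX
  cases hX
  assumption

/-! ### Direct sum decompositions -/

/-- Every object of a length category is a finite direct sum of indecomposable objects. Only the
part of the biproduct structure that matters here is recorded. -/
theorem exists_decomposition (Z : A) :
    ∃ (ι : Type) (_ : Fintype ι) (Y : ι → A) (π : ∀ i, Z ⟶ Y i) (inc : ∀ i, Y i ⟶ Z),
      (∀ i, Indecomposable (Y i)) ∧ (∀ i, inc i ≫ π i = 𝟙 (Y i)) ∧
      ∑ i, π i ≫ inc i = 𝟙 Z := by
  induction hn : length Z using Nat.strong_induction_on generalizing Z with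
  | _ n ih =>
  by_cases hZ : IsZero Z
  · exact ⟨PEmpty, inferInstance, PEmpty.elim, fun i => i.elim, fun i => i.elim,
      fun i => i.elim, fun i => i.elim, hZ.eq_of_src _ _⟩
  by_cases hI : Indecomposable Z
  · exact ⟨Unit, inferInstance, fun _ => Z, fun _ => 𝟙 Z, fun _ => 𝟙 Z, fun _ => hI,
      fun _ => by simp, by simp⟩
  obtain ⟨B, C, e, hB, hC⟩ : ∃ (B C : A) (_ : Z ≅ B ⊞ C), ¬ IsZero B ∧ ¬ IsZero C := by
    by_contra! hcon
    exact hI ⟨hZ, fun B C e => or_iff_not_imp_left.2 (hcon B C e)⟩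
  have hlt : ∀ {V W : A} (i : V ⟶ Z) (r : Z ⟶ V) (j : W ⟶ Z), i ≫ r = 𝟙 V → ¬ IsZero W →
      Mono j → j ≫ r = 0 → length V < n := by
    intro V W i r j hir hW hj hjr
    have : Mono (i ≫ r) := hir ▸ inferInstance
    have : Mono i := mono_of_mono i r
    by_contra! hle
    have := isIso_of_mono_of_length_le i (hn ▸ hle)
    have hr : r = inv i := by rw [← cancel_epi i, hir, IsIso.hom_inv_id]
    have : IsIso r := hr ▸ inferInstance
    have : j = 0 := by rw [← cancel_mono r, hjr, zero_comp]
    exact hW ((IsZero.iff_id_eq_zero W).2 (by rw [← cancel_mono j, this, comp_zero, comp_zero]))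
  obtain ⟨ι, _, Y, π, inc, h1, h2, h3⟩ := ih _ (hlt (biprod.inl ≫ e.inv) (e.hom ≫ biprod.fst)
    (biprod.inr ≫ e.inv) (by simp) hC inferInstance (by simp)) B rfl
  obtain ⟨ι', _, Y', π', inc', h1', h2', h3'⟩ := ih _ (hlt (biprod.inr ≫ e.inv)
    (e.hom ≫ biprod.snd) (biprod.inl ≫ e.inv) (by simp) hB inferInstance (by simp)) C rfl
  refine ⟨ι ⊕ ι', inferInstance, Sum.elim Y Y',
    Sum.rec (fun i => (e.hom ≫ biprod.fst) ≫ π i) (fun i => (e.hom ≫ biprod.snd) ≫ π' i),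
    Sum.rec (fun i => inc i ≫ biprod.inl ≫ e.inv) (fun i => inc' i ≫ biprod.inr ≫ e.inv),
    ?_, ?_, ?_⟩
  · rintro (i | i)
    exacts [h1 i, h1' i]
  · rintro (i | i)
    · simpa using h2 i
    · simpa using h2' i
  · have ha : ∑ i, ((e.hom ≫ biprod.fst) ≫ π i) ≫ inc i ≫ (biprod.inl ≫ e.inv) =
        (e.hom ≫ biprod.fst) ≫ (∑ i, π i ≫ inc i) ≫ (biprod.inl ≫ e.inv) := by
      simp only [Preadditive.comp_sum, Preadditive.sum_comp, Category.assoc]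
    have hb : ∑ i, ((e.hom ≫ biprod.snd) ≫ π' i) ≫ inc' i ≫ (biprod.inr ≫ e.inv) =
        (e.hom ≫ biprod.snd) ≫ (∑ i, π' i ≫ inc' i) ≫ (biprod.inr ≫ e.inv) := by
      simp only [Preadditive.comp_sum, Preadditive.sum_comp, Category.assoc]
    rw [Fintype.sum_sum_type]
    refine (congrArg₂ (· + ·) ha hb).trans ?_
    rw [h3, h3', Category.id_comp, Category.id_comp]
    have := biprod.total (X := B) (Y := C)
    calc _ = e.hom ≫ (biprod.fst ≫ biprod.inl + biprod.snd ≫ biprod.inr) ≫ e.inv := by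
          simp only [Preadditive.comp_add, Preadditive.add_comp, Category.assoc]
      _ = _ := by rw [this]; simp

end Length

/-! ### Lexicographic order and the chain length function -/

namespace ChainNat

theorem le_of_subset {a b : ChainNat} (h : a.carrier ⊆ b.carrier) : a ≤ b := by
  rw [le_def, Finset.sdiff_eq_empty_iff_subset.2 h, Finset.min_empty]
  exact le_top

/-- If `a < b` and no element of `a` or `b` exceeds `n`, then adjoining `n` to `a` does not move it
beyond `b`. -/
theorem insert_le_of_lt {a b : ChainNat} {n : ℕ} (hab : a < b) (ha : ∀ i ∈ a.carrier, i ≤ n)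
    (hb : ∀ i ∈ b.carrier, i ≤ n) : (⟨insert n a.carrier⟩ : ChainNat) ≤ b := by
  obtain ⟨hle, hne⟩ := lt_iff_le_and_ne.1 hab
  have hmem : ∃ p, p ∈ b.carrier \ a.carrier := by
    by_contra! hcon
    exact hne (le_antisymm hle (le_of_subset fun i hi => by
      by_contra hi'
      exact hcon i (Finset.mem_sdiff.2 ⟨hi, hi'⟩)))
  obtain ⟨p, hp⟩ := Finset.min_of_mem hmem.choose_spec
  have hpm := Finset.mem_sdiff.1 (Finset.mem_of_min hp)
  have hpa : ∀ i ∈ a.carrier, i ∉ b.carrier → p < i := by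
    intro i hi hi'
    rw [le_def, hp] at hle
    refine lt_of_le_of_ne (WithTop.coe_le_coe.1 (hle.trans
      (Finset.min_le (Finset.mem_sdiff.2 ⟨hi, hi'⟩)))) ?_
    rintro rfl
    exact hpm.2 hi
  rcases (hb p hpm.1).eq_or_lt with rfl | hpn
  · refine le_of_subset fun i hi => ?_
    rcases Finset.mem_insert.1 hi with rfl | hi
    · exact hpm.1
    · by_contra hi'
      exact absurd (hpa i hi hi') (not_lt.2 (ha i hi))
  · rw [le_def]
    refine (Finset.min_le (a := p) ?_).trans (Finset.le_min fun i hi => ?_)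
    · simp [hpm.1, hpm.2, hpn.ne]
    · obtain ⟨hi, hi'⟩ := Finset.mem_sdiff.1 hi
      rcases Finset.mem_insert.1 hi with rfl | hi
      · exact WithTop.coe_le_coe.2 hpn.le
      · exact WithTop.coe_le_coe.2 (hpa i hi hi').le

end ChainNat

section ChainLength

variable {S : Type*} [Preorder S] {lam : S → ℕ}

theorem isGreatest_chainLength_carrier (h : Monotone lam) (x : S) :
    IsGreatest ((chainLength lam x).carrier : Set ℕ) (lam x) := by
  classical
  obtain ⟨C, ⟨-, hx, hC⟩, he⟩ := (isGreatest_chainLength h x).1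
  rw [he]
  refine ⟨by simpa using ⟨x, hx, rfl⟩, fun n hn => ?_⟩
  obtain ⟨y, hy, rfl⟩ : ∃ y ∈ C, lam y = n := by simpa using hn
  exact h (hC hy)

theorem chainLength_mono (h : Monotone lam) : Monotone (chainLength lam) := by
  classical
  intro x y hxy
  obtain ⟨C, ⟨hch, hx, hC⟩, he⟩ := (isGreatest_chainLength h x).1
  have hmem : (⟨(insert y C).image lam⟩ : ChainNat) ∈ chainLengths lam y := by
    refine ⟨insert y C, ⟨?_, ?_, ?_⟩, rfl⟩
    · rw [Finset.coe_insert]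
      exact hch.insert fun b hb _ => Or.inr ((hC hb).trans hxy)
    · simp
    · rw [Finset.coe_insert]
      rintro b (rfl | hb)
      exacts [le_rfl, (hC hb).trans hxy]
  refine le_trans ?_ ((isGreatest_chainLength h y).2 hmem)
  rw [he]
  exact ChainNat.le_of_subset (Finset.image_subset_image (Finset.subset_insert _ _))

theorem lam_eq_of_chainLength_eq (h : Monotone lam) {x y : S}
    (hxy : chainLength lam x = chainLength lam y) : lam x = lam y :=
  (isGreatest_chainLength_carrier h x).unique (hxy ▸ isGreatest_chainLength_carrier h y)

/-- A bound on the chain length function at `x` in terms of the elements of smaller length below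
`x`. -/
theorem chainLength_le_of_forall_lt (h : Monotone lam) {x y : S} (hxy : lam y ≤ lam x)
    (hlt : ∀ z, z ≤ x → lam z < lam x → chainLength lam z < chainLength lam y) :
    chainLength lam x ≤ chainLength lam y := by
  classical
  obtain ⟨C, ⟨hch, hx, hC⟩, he⟩ := (isGreatest_chainLength h x).1
  set D := C.filter (fun z => lam z < lam x) with hD
  have hlow : (⟨D.image lam⟩ : ChainNat) < chainLength lam y := by
    rcases D.eq_empty_or_nonempty with hD0 | hD0
    · refine lt_of_le_of_ne (ChainNat.le_of_subset (by simp [hD0])) fun heq => ?_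
      have := (isGreatest_chainLength_carrier h y).1
      rw [← heq] at this
      simp [hD0] at this
    · obtain ⟨z, hz⟩ := D.exists_maximal hD0
      have hzC := Finset.mem_filter.1 hz.1
      have hchD : IsChain (· ≤ ·) (D : Set S) := hch.mono (Finset.filter_subset _ _)
      have hmax : ∀ w ∈ D, w ≤ z := fun w hw => by
        rcases hchD.total hw hz.1 with h' | h'
        exacts [h', hz.2 hw h']
      exact ((isGreatest_chainLength h z).2 ⟨D, ⟨hchD, hz.1, hmax⟩, rfl⟩).trans_lt
        (hlt z (hC hzC.1) hzC.2)
  have himg : C.image lam = insert (lam x) (D.image lam) := by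
    ext n
    simp only [Finset.mem_image, Finset.mem_insert, hD, Finset.mem_filter]
    constructor
    · rintro ⟨z, hz, rfl⟩
      rcases (h (hC hz)).eq_or_lt with h' | h'
      exacts [Or.inl h', Or.inr ⟨z, ⟨hz, h'⟩, rfl⟩]
    · rintro (rfl | ⟨z, hz, rfl⟩)
      exacts [⟨x, hx, rfl⟩, ⟨z, hz.1, rfl⟩]
  rw [he, himg]
  refine ChainNat.insert_le_of_lt hlow ?_ fun i hi =>
    ((isGreatest_chainLength_carrier h y).2 hi).trans hxy
  intro i hi
  obtain ⟨z, hz, rfl⟩ := Finset.mem_image.1 hi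
  exact (Finset.mem_filter.1 hz).2.le

end ChainLength

end GabrielRoiter

namespace GabrielRoiter

variable {A : Type u} [Category.{v} A]

/-! ### Composites of non-isomorphisms between indecomposable objects -/

/-- `IsNonIsoComposite S n f` means that `f` is a composite of `n` non-isomorphisms between objects
satisfying `S`; for `n = 0` this is the identity of such an object. -/
inductive IsNonIsoComposite (S : A → Prop) : ℕ → ∀ {X Y : A}, (X ⟶ Y) → Prop
  | id (X : A) (hX : S X) : IsNonIsoComposite S 0 (𝟙 X)
  | comp {X Y Z : A} {n : ℕ} (h : X ⟶ Y) (f : Y ⟶ Z) (hX : S X) (hh : ¬ IsIso h)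
      (hf : IsNonIsoComposite S n f) : IsNonIsoComposite S (n + 1) (h ≫ f)

namespace IsNonIsoComposite

variable {S : A → Prop}

theorem source {n : ℕ} {X Y : A} {f : X ⟶ Y} (hf : IsNonIsoComposite S n f) : S X := by
  cases hf <;> assumption

theorem target {n : ℕ} {X Y : A} {f : X ⟶ Y} (hf : IsNonIsoComposite S n f) : S Y := by
  induction hf <;> assumption

theorem exists_split {m : ℕ} : ∀ {n : ℕ} {X Y : A} {f : X ⟶ Y},
    IsNonIsoComposite S (n + m) f → ∃ (Z : A) (g : X ⟶ Z) (g' : Z ⟶ Y),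
      IsNonIsoComposite S n g ∧ IsNonIsoComposite S m g' ∧ g ≫ g' = f
  | 0, X, _, f, hf => ⟨X, 𝟙 X, f, .id X hf.source, by simpa using hf, Category.id_comp _⟩
  | n + 1, X, Y, f, hf => by
    rw [Nat.add_right_comm] at hf
    cases hf with
    | comp h f hX hh hf =>
      obtain ⟨Z, g, g', hg, hg', rfl⟩ := exists_split hf
      exact ⟨Z, h ≫ g, g', .comp h g hX hh hg, hg', Category.assoc _ _ _⟩

variable [Abelian A] [IsLengthCategory A]

/-- The Harada-Sai lemma. If `f ≫ h ≫ g` is not smaller than `f` and `g`, then it restricts to an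
isomorphism from the image of `f` to the image of `g`; by indecomposability these images are all of
the source and the target of `h`, so that `h` is an isomorphism. -/
theorem length_image_le (hS : ∀ X, S X → Indecomposable X) {b : ℕ} (hb : ∀ X, S X → length X ≤ b)
    (m : ℕ) : ∀ {X Y : A} {f : X ⟶ Y},
      IsNonIsoComposite S (2 ^ m - 1) f → length (image f) ≤ b - m := by
  induction m with
  | zero =>
    intro X Y f hf
    exact (length_le_of_mono (image.ι f)).trans (hb _ hf.target)
  | succ m ih =>
    intro X Y p hp
    have h2 : 2 ^ (m + 1) - 1 = (2 ^ m - 1) + ((2 ^ m - 1) + 1) := by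
      have := Nat.one_le_two_pow (n := m)
      omega
    rw [h2] at hp
    obtain ⟨B, f, r, hf, hr, rfl⟩ := hp.exists_split
    cases hr with
    | @comp _ C _ _ h g _ hh hg =>
    have hlf := ih hf
    have hlg := ih hg
    by_contra! hlt
    obtain ⟨θ, hθ⟩ : ∃ θ : image f ⟶ image g, θ = image.ι f ≫ h ≫ factorThruImage g := ⟨_, rfl⟩
    let M : MonoFactorisation (f ≫ h ≫ g) :=
      { I := image θ
        m := image.ι θ ≫ image.ι g
        e := factorThruImage f ≫ factorThruImage θ
        fac := by simp [hθ] }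
    have hM : length (image (f ≫ h ≫ g)) ≤ length (image θ) := length_le_of_mono (image.lift M)
    have h1 : IsIso (factorThruImage θ) := isIso_of_epi_of_length_le _ (by omega)
    have h2 : IsIso (image.ι θ) := isIso_of_mono_of_length_le _ (by omega)
    have h3 : IsIso θ := by
      rw [← image.fac θ]
      infer_instance
    have hne : ∀ {V : A}, (θ' : image θ ≅ V) → ¬ IsZero V := fun θ' hV => by
      have h0 : length (image θ) ≤ 0 := Nat.sInf_le (.zero (hV.of_iso θ'))
      omega
    have hif : IsIso (image.ι f) := isIso_of_retract_of_indecomposable (hS _ hf.target)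
      (hne (asIso (factorThruImage θ)).symm) (image.ι f) (h ≫ factorThruImage g ≫ inv θ) (by
        rw [← Category.assoc h, ← Category.assoc, ← hθ, IsIso.hom_inv_id])
    have hs : (inv θ ≫ image.ι f ≫ h) ≫ factorThruImage g = 𝟙 _ := by
      rw [Category.assoc, Category.assoc, ← hθ, IsIso.inv_hom_id]
    have hs' := isIso_of_retract_of_indecomposable (hS _ hg.source)
      (hne (asIso (image.ι θ))) _ _ hs
    have : IsIso (image.ι f ≫ h) := IsIso.of_isIso_comp_left (inv θ) _
    exact hh (IsIso.of_isIso_comp_left (image.ι f) h)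

theorem eq_zero (hS : ∀ X, S X → Indecomposable X) {b : ℕ} (hb : ∀ X, S X → length X ≤ b)
    {X Y : A} {f : X ⟶ Y} (hf : IsNonIsoComposite S (2 ^ b - 1) f) : f = 0 := by
  have h := hf.length_image_le hS hb
  rw [Nat.sub_self] at h
  rw [← image.fac f, (isZero_of_length_eq_zero (Nat.le_zero.1 h)).eq_of_src (image.ι f) 0,
    comp_zero]

end IsNonIsoComposite

/-! ### Gabriel's main property -/

variable [Abelian A]

namespace Ind

theorem mk_eq_mk {X Y : A} (hX : Indecomposable X) (hY : Indecomposable Y) :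
    mk X hX = mk Y hY ↔ Nonempty (X ≅ Y) :=
  Quotient.eq (r := indSetoid A)

variable [IsLengthCategory A]

theorem len_mono : Monotone (len (A := A)) := by
  rintro ⟨X⟩ ⟨Y⟩ ⟨f, hf⟩
  exact length_le_of_mono f

theorem measure_le_of_mono {X Y : A} (hX : Indecomposable X) (hY : Indecomposable Y) (f : X ⟶ Y)
    [Mono f] : (mk X hX).measure ≤ (mk Y hY).measure :=
  chainLength_mono len_mono ((mk_le_mk hX hY).2 ⟨f, inferInstance⟩)

theorem length_eq_of_measure_eq {X Y : A} {hX : Indecomposable X} {hY : Indecomposable Y}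
    (h : (mk X hX).measure = (mk Y hY).measure) : length X = length Y :=
  lam_eq_of_chainLength_eq len_mono h

theorem finite_measures_of_length_le (n : ℕ) :
    {m : ChainNat | ∃ (X : A) (hX : Indecomposable X), length X ≤ n ∧
      (mk X hX).measure = m}.Finite := by
  refine ((Finset.finite_toSet (Finset.range (n + 1)).powerset).image ChainNat.mk).subset ?_
  rintro _ ⟨X, hX, hn, rfl⟩
  refine ⟨(mk X hX).measure.carrier, ?_, rfl⟩
  rw [Finset.mem_coe, Finset.mem_powerset]
  intro i hi
  have : i ≤ length X := (isGreatest_chainLength_carrier len_mono (mk X hX)).2 hi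
  exact Finset.mem_range.2 (by omega)

/-- Gabriel's main property for a family `P` of morphisms from `X` to indecomposable objects which
is jointly monic. The induction on the length of `X` uses the family of epimorphisms from `X` to the
indecomposable summands of the images of the given morphisms. -/
theorem main_property {X : A} (hX : Indecomposable X) (P : ∀ Y : A, (X ⟶ Y) → Prop)
    (hP : ∀ Y f, P Y f → Indecomposable Y)
    (hmono : ∀ {T : A} (k : T ⟶ X), (∀ Y f, P Y f → k ≫ f = 0) → k = 0) :
    (∃ (Y : A) (f : X ⟶ Y) (hf : P Y f), (mk X hX).measure ≤ (mk Y (hP Y f hf)).measure) ∧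
    ((∀ (Y : A) (f : X ⟶ Y) (hf : P Y f), (mk Y (hP Y f hf)).measure ≤ (mk X hX).measure) →
      ∃ (Y : A) (f : X ⟶ Y), P Y f ∧ IsIso f) := by
  induction hn : length X using Nat.strong_induction_on generalizing X with
  | _ n ih =>
  let E : ∀ V : A, (X ⟶ V) → Prop := fun V g => Indecomposable V ∧ Epi g ∧
    ∃ (Y : A) (f : X ⟶ Y), P Y f ∧ ∃ (r : image f ⟶ V) (j : V ⟶ Y), Mono j ∧
      factorThruImage f ≫ r = g
  have hE : ∀ V g, E V g → Indecomposable V := fun V g h => h.1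
  have hEmono : ∀ {T : A} (k : T ⟶ X), (∀ V g, E V g → k ≫ g = 0) → k = 0 := by
    intro T k hk
    refine hmono k fun Y f hf => ?_
    obtain ⟨ι, _, V, π, inc, h1, h2, h3⟩ := exists_decomposition (image f)
    have hki : ∀ i, k ≫ factorThruImage f ≫ π i = 0 := by
      intro i
      have : Epi (π i) := ⟨fun a b hab => by
        rw [← Category.id_comp a, ← Category.id_comp b, ← h2 i, Category.assoc, Category.assoc,
          hab]⟩
      have : Mono (inc i) := ⟨fun a b hab => by
        rw [← Category.comp_id a, ← Category.comp_id b, ← h2 i, ← Category.assoc,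
          ← Category.assoc, hab]⟩
      exact hk _ _ ⟨h1 i, epi_comp _ _, Y, f, hf, π i, inc i ≫ image.ι f, mono_comp _ _, rfl⟩
    have h0 : k ≫ factorThruImage f = 0 := by
      rw [← Category.comp_id (k ≫ factorThruImage f), ← h3, Preadditive.comp_sum]
      refine Finset.sum_eq_zero fun i _ => ?_
      rw [← Category.assoc, Category.assoc k, hki, zero_comp]
    rw [← image.fac f, ← Category.assoc, h0, zero_comp]
  have hEP : ∀ V g (hg : E V g), ∃ (Y : A) (f : X ⟶ Y) (hf : P Y f),
      (mk V (hE V g hg)).measure ≤ (mk Y (hP Y f hf)).measure := by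
    rintro V g ⟨hV, -, Y, f, hf, r, j, hj, -⟩
    exact ⟨Y, f, hf, measure_le_of_mono hV _ j⟩
  -- All measures of members of `E` are bounded by the length of `X`, hence attain a maximum.
  obtain ⟨V, g, hg, hmax⟩ : ∃ (V : A) (g : X ⟶ V) (hg : E V g), ∀ V' g' (hg' : E V' g'),
      (mk V' (hE V' g' hg')).measure ≤ (mk V (hE V g hg)).measure := by
    let M : Set ChainNat := {m | ∃ (V : A) (g : X ⟶ V) (hg : E V g),
      (mk V (hE V g hg)).measure = m}
    have hM : M.Finite := by
      refine (finite_measures_of_length_le (A := A) (length X)).subset ?_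
      rintro _ ⟨V, g, hg, rfl⟩
      have := hg.2.1
      exact ⟨V, hg.1, length_le_of_epi g, rfl⟩
    have hMne : M.Nonempty := by
      by_contra hemp
      refine hX.1 ((IsZero.iff_id_eq_zero X).2 (hEmono _ fun V g hg => ?_))
      exact (hemp ⟨_, V, g, hg, rfl⟩).elim
    obtain ⟨_, ⟨V, g, hg, rfl⟩, hmax⟩ := Set.exists_max_image M id hM hMne
    exact ⟨V, g, hg, fun V' g' hg' => hmax _ ⟨V', g', hg', rfl⟩⟩
  have hgepi : Epi g := hg.2.1
  have hle : (mk X hX).measure ≤ (mk V (hE V g hg)).measure := by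
    refine chainLength_le_of_forall_lt len_mono (length_le_of_epi g) ?_
    rintro ⟨X', hX'⟩ ⟨i, hi⟩ hlt
    change X' ⟶ X at i
    change length X' < length X at hlt
    have hrestr : ∀ {T : A} (k : T ⟶ X'),
        (∀ W g', (∃ u, E W u ∧ g' = i ≫ u) → k ≫ g' = 0) → k = 0 := by
      intro T k hk
      rw [← cancel_mono i, zero_comp]
      refine hEmono _ fun W u hu => ?_
      rw [Category.assoc]
      exact hk W _ ⟨u, hu, rfl⟩
    obtain ⟨⟨W, g', ⟨u, hu, hgu⟩, hW⟩, hiso⟩ := ih _ (hn ▸ hlt) hX'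
      (fun W g' => ∃ u, E W u ∧ g' = i ≫ u) (fun W g' h => h.elim fun u hu => hu.1.1)
      hrestr rfl
    refine lt_of_le_of_ne (hW.trans (hmax W u hu)) fun heq => ?_
    obtain ⟨W', _, ⟨u', hu', rfl⟩, hiu⟩ := hiso fun W' g'' ⟨u', hu', _⟩ =>
      (hmax W' u' hu').trans heq.ge
    -- A component of the restriction to `X'` is invertible, so `X'` is a summand of `X`.
    have := isIso_of_retract_of_indecomposable hX hX'.1 i (u' ≫ inv (i ≫ u'))
      (by rw [← Category.assoc, IsIso.hom_inv_id])
    exact hlt.ne (length_eq_of_iso (asIso i))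
  refine ⟨?_, fun hbound => ?_⟩
  · obtain ⟨Y, f, hf, h⟩ := hEP V g hg
    exact ⟨Y, f, hf, hle.trans h⟩
  · have hVX : length V = length X := by
      obtain ⟨Y, f, hf, h⟩ := hEP V g hg
      exact length_eq_of_measure_eq ((h.trans (hbound Y f hf)).antisymm hle)
    have hgiso : IsIso g := isIso_of_epi_of_length_le g hVX.ge
    obtain ⟨hV, -, Y, f, hf, r, j, hj, hr⟩ := hg
    have : Mono (factorThruImage f) := mono_of_mono_fac hr
    have hfm : Mono f := by
      rw [← image.fac f]
      infer_instance
    have hYX : length Y = length X := length_eq_of_measure_eq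
      ((hbound Y f hf).antisymm (measure_le_of_mono hX (hP Y f hf) f))
    exact ⟨Y, f, hf, isIso_of_mono_of_length_le f hYX.le⟩

/-! ### A finite cogenerating set for the complement of a finite set -/

attribute [local instance] Abelian.hasFiniteBiproducts

/-- A right almost split map to `M`, decomposed into its components on the indecomposable summands
of its source. The set `W` of their isomorphism classes depends only on the class of `M`. -/
theorem exists_finite_almost_split (hras : HasRightAlmostSplitMaps A) (q : Ind A) :
    ∃ W : Set (Ind A), W.Finite ∧ ∀ (M : A) (hM : Indecomposable M), mk M hM = q →
      ∃ (ι : Type) (_ : Fintype ι) (Y : ι → A) (hY : ∀ i, Indecomposable (Y i))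
        (ρ : ∀ i, Y i ⟶ M), (∀ i, mk (Y i) (hY i) ∈ W) ∧ (∀ i, ¬ IsIso (ρ i)) ∧
        ∀ {X : A} (f : X ⟶ M), ¬ IsSplitEpi f →
          ∃ a : ∀ i, X ⟶ Y i, f = ∑ i, a i ≫ ρ i := by
  obtain ⟨⟨M₀, hM₀⟩, rfl⟩ := Quotient.exists_rep q
  obtain ⟨B, g, hg, hfac⟩ := hras M₀ hM₀
  obtain ⟨ι, _, Y, π, inc, h1, h2, h3⟩ := exists_decomposition B
  refine ⟨Set.range fun i => mk (Y i) (h1 i), Set.finite_range _, fun M hM hq => ?_⟩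
  obtain ⟨e⟩ := (mk_eq_mk hM hM₀).1 hq
  refine ⟨ι, inferInstance, Y, h1, fun i => inc i ≫ g ≫ e.inv, fun i => ⟨i, rfl⟩,
    fun i hi => hg ?_, fun {X} f hf => ?_⟩
  · exact ⟨⟨⟨e.inv ≫ inv (inc i ≫ g ≫ e.inv) ≫ inc i, by
      rw [← cancel_mono e.inv]
      simp only [Category.assoc, IsIso.inv_hom_id, Category.comp_id, Category.id_comp]⟩⟩⟩
  · obtain ⟨k, hk⟩ := hfac X (f ≫ e.hom) fun ⟨⟨s⟩⟩ => hf ⟨⟨⟨e.hom ≫ s.section_, by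
      rw [← cancel_mono e.hom, Category.assoc, Category.assoc, s.id, Category.comp_id,
        Category.id_comp]⟩⟩⟩
    refine ⟨fun i => k ≫ π i, ?_⟩
    have : ∑ i, (k ≫ π i) ≫ inc i ≫ g ≫ e.inv = k ≫ (∑ i, π i ≫ inc i) ≫ g ≫ e.inv := by
      simp only [Preadditive.comp_sum, Preadditive.sum_comp, Category.assoc]
    rw [this, h3, Category.id_comp, ← Category.assoc, hk, Category.assoc, e.hom_inv_id,
      Category.comp_id]

/-- For a finite set `F`, finitely many indecomposable objects outside `F` cogenerate all
indecomposable objects outside `F`. Morphisms to members of `F` are expanded along right almost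
split maps; the terms that never leave `F` vanish by the Harada-Sai lemma. -/
theorem exists_finite_cogenerating (hcog : ∃ Q : A, IsCogenerator Q)
    (hras : HasRightAlmostSplitMaps A) {F : Set (Ind A)} (hF : F.Finite) :
    ∃ W : Set (Ind A), W.Finite ∧ (∀ w ∈ W, w ∉ F) ∧
      ∀ (X : A) (hX : Indecomposable X), mk X hX ∉ F → ∀ {T : A} (k : T ⟶ X),
        (∀ (Y : A) (hY : Indecomposable Y) (f : X ⟶ Y), mk Y hY ∈ W → k ≫ f = 0) → k = 0 := by
  obtain ⟨Q, hQ⟩ := hcog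
  obtain ⟨κ, _, C, πQ, incQ, hC, -, hQsum⟩ := exists_decomposition Q
  choose W hWfin hW using exists_finite_almost_split hras
  refine ⟨(Set.range (fun i => mk (C i) (hC i)) ∪ ⋃ q ∈ F, W q) \ F,
    ((Set.finite_range _).union (hF.biUnion fun q _ => hWfin q)).sdiff, fun w hw => hw.2, ?_⟩
  intro X hX hXF T k hk
  let S : A → Prop := fun M => ∃ hM : Indecomposable M, mk M hM ∈ F
  obtain ⟨b, hb⟩ := (hF.image len).bddAbove
  have hSb : ∀ M, S M → length M ≤ b := fun M ⟨hM, hMF⟩ => hb ⟨_, hMF, rfl⟩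
  have hexpand : ∀ (n : ℕ) (M : A), S M → ∀ f : X ⟶ M, k ≫ f ≠ 0 →
      ∃ (M' : A) (f' : X ⟶ M') (p : M' ⟶ M), IsNonIsoComposite S n p ∧ k ≫ f' ≫ p ≠ 0 := by
    intro n M hM f hf
    induction n with
    | zero => exact ⟨M, f, 𝟙 M, .id M hM, by simpa using hf⟩
    | succ n ih =>
      obtain ⟨M', f', p, hp, hne⟩ := ih
      obtain ⟨hM', hM'F⟩ := hp.source
      obtain ⟨ι, _, Y, hY, ρ, hYW, hρ, hfac⟩ := hW _ M' hM' rfl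
      have hsplit : ¬ IsSplitEpi f' := fun ⟨⟨s⟩⟩ => by
        have := isIso_of_retract_of_indecomposable hX hM'.1 s.section_ f' s.id
        exact hXF ((mk_eq_mk hX hM').2 ⟨(asIso s.section_).symm⟩ ▸ hM'F)
      obtain ⟨a, ha⟩ := hfac f' hsplit
      obtain ⟨i, hi⟩ : ∃ i, k ≫ a i ≫ ρ i ≫ p ≠ 0 := by
        by_contra! hcon
        refine hne ?_
        rw [ha, Preadditive.sum_comp, Preadditive.comp_sum]
        exact Finset.sum_eq_zero fun i _ => by rw [Category.assoc, hcon i]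
      have hiF : mk (Y i) (hY i) ∈ F := by
        by_contra hiF
        refine hi ?_
        rw [← Category.assoc, hk (Y i) (hY i) (a i)
          ⟨Or.inr (Set.mem_biUnion hM'F (hYW i)), hiF⟩, zero_comp]
      exact ⟨Y i, a i, ρ i ≫ p, .comp _ _ ⟨hY i, hiF⟩ (hρ i) hp, hi⟩
  have hzero : ∀ (M : A), S M → ∀ f : X ⟶ M, k ≫ f = 0 := by
    intro M hM f
    by_contra hf
    obtain ⟨M', f', p, hp, hne⟩ := hexpand (2 ^ b - 1) M hM f hf
    exact hne (by rw [hp.eq_zero (fun M h => h.1) hSb, comp_zero, comp_zero])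
  have hkQ : ∀ f : X ⟶ Q, k ≫ f = 0 := by
    intro f
    rw [← Category.comp_id f, ← hQsum, Preadditive.comp_sum, Preadditive.comp_sum]
    refine Finset.sum_eq_zero fun i _ => ?_
    have : k ≫ f ≫ πQ i = 0 := by
      by_cases hi : mk (C i) (hC i) ∈ F
      · exact hzero _ ⟨hC i, hi⟩ _
      · exact hk _ (hC i) _ ⟨Or.inl ⟨i, rfl⟩, hi⟩
    rw [← Category.assoc, ← Category.assoc, Category.assoc k, this, zero_comp]
  obtain ⟨n, f, hf⟩ := hQ X
  rw [← cancel_mono f, zero_comp]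
  refine biproduct.hom_ext _ _ fun j => ?_
  rw [Category.assoc, hkQ, zero_comp]

/-! ### The terminal segment -/

/-- The largest measure outside a finite set `F` is attained, and by finitely many classes only. -/
theorem exists_max_measure_notMem [Infinite (Ind A)] (hcog : ∃ Q : A, IsCogenerator Q)
    (hras : HasRightAlmostSplitMaps A) {F : Set (Ind A)} (hF : F.Finite) :
    ∃ q ∉ F, (∀ y ∉ F, y.measure ≤ q.measure) ∧ {y | y ∉ F ∧ y.measure = q.measure}.Finite := by
  obtain ⟨W, hWfin, hWF, hW⟩ := exists_finite_cogenerating hcog hras hF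
  have key : ∀ y ∉ F, (∃ w ∈ W, y.measure ≤ w.measure) ∧
      ((∀ w ∈ W, w.measure ≤ y.measure) → y ∈ W) := by
    rintro ⟨X, hX⟩ hXF
    obtain ⟨⟨Y, f, ⟨hY, hYW⟩, hle⟩, hiso⟩ := main_property hX
      (fun Y _ => ∃ hY : Indecomposable Y, mk Y hY ∈ W) (fun Y f h => h.1)
      (fun k hk => hW X hX hXF k fun Y hY f hYW => hk Y f ⟨hY, hYW⟩)
    refine ⟨⟨mk Y hY, hYW, hle⟩, fun hbound => ?_⟩
    obtain ⟨Z, g, ⟨hZ, hZW⟩, hg⟩ := hiso fun Z _ ⟨hZ, hZW⟩ => hbound _ hZW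
    exact ((mk_eq_mk hX hZ).2 ⟨asIso g⟩ ▸ hZW :)
  obtain ⟨x, hx⟩ := hF.exists_notMem
  obtain ⟨w, hw, -⟩ := (key x hx).1
  obtain ⟨q, hq, hmax⟩ := Set.exists_max_image W measure hWfin ⟨w, hw⟩
  refine ⟨q, hWF q hq, fun y hy => ?_, hWfin.subset ?_⟩
  · obtain ⟨w, hw, hyw⟩ := (key y hy).1
    exact hyw.trans (hmax w hw)
  · rintro y ⟨hy, hyq⟩
    exact (key y hy).2 fun w hw => (hmax w hw).trans hyq.ge

end Ind

end GabrielRoiter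


theorem theorem4p6 {A : Type u} [Category.{v} A] [Abelian A]
    [GabrielRoiter.IsLengthCategory A]
    (hinf : Infinite (GabrielRoiter.Ind A))
    (hcog : ∃ Q : A, GabrielRoiter.IsCogenerator Q)
    (hras : GabrielRoiter.HasRightAlmostSplitMaps A) :
    ∃ X : ℕ → GabrielRoiter.Ind A,
      (∀ i, (X (i + 1)).measure < (X i).measure) ∧
      (∀ Y : GabrielRoiter.Ind A, (∀ i, Y.measure ≠ (X i).measure) →
        ∀ i, Y.measure < (X i).measure) ∧
      (∀ i, {Y : GabrielRoiter.Ind A | Y.measure = (X i).measure}.Finite) := by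
  choose next hnext hmax hfin using fun F : {F : Set (GabrielRoiter.Ind A) // F.Finite} =>
    GabrielRoiter.Ind.exists_max_measure_notMem hcog hras F.2
  -- `F i` consists of the classes whose measure is one of the `i` largest ones.
  let F : ℕ → {F : Set (GabrielRoiter.Ind A) // F.Finite} := fun i =>
    Nat.rec ⟨∅, Set.finite_empty⟩
      (fun _ G => ⟨G.1 ∪ {y | y ∉ G.1 ∧ y.measure = (next G).measure}, G.2.union (hfin G)⟩) i
  have hsucc : ∀ i y, y ∈ (F (i + 1)).1 ↔
      y ∈ (F i).1 ∨ y ∉ (F i).1 ∧ y.measure = (next (F i)).measure := fun i y => Iff.rfl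
  have hup : ∀ i, ∀ y ∉ (F i).1, ∀ z ∈ (F i).1, y.measure < z.measure := by
    intro i
    induction i with
    | zero => exact fun _ _ z hz => hz.elim
    | succ i ih =>
      intro y hy z hz
      rw [hsucc, not_or, not_and] at hy
      rcases (hsucc i z).1 hz with hz | ⟨-, hz⟩
      · exact ih y hy.1 z hz
      · rw [hz]
        exact lt_of_le_of_ne (hmax _ y hy.1) (hy.2 hy.1)
  have hmem : ∀ i, next (F i) ∈ (F (i + 1)).1 := fun i => Or.inr ⟨hnext _, rfl⟩
  refine ⟨fun i => next (F i), fun i => hup (i + 1) _ (hnext _) _ (hmem i), fun Y hY i => ?_,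
    fun i => (hfin (F i)).subset fun Y hY => ⟨fun hYF => ?_, hY⟩⟩
  · have hYF : ∀ j, Y ∉ (F j).1 := by
      intro j
      induction j with
      | zero => exact fun h => h
      | succ j ih =>
        rw [hsucc]
        rintro (h | ⟨-, h⟩)
        exacts [ih h, hY j h]
    exact hup (i + 1) Y (hYF (i + 1)) _ (hmem i)
  · exact (hup i _ (hnext _) _ hYF).ne' hY
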